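/- For a cardinal $\kappa$ and a set $A$ let $\mathcal P_\kappa A=\{x\subseteq A:|x|<\kappa\}$. A set $X\subseteq\mathcal P_\kappa A$ is unbounded if every $x\in\mathcal P_\kappa A$ is contained in some $y\in X$. It is club if it is unbounded and closed under unions of nonempty $\subseteq$-chains of fewer than $\kappa$ of its members. A subset of $\mathcal P_\kappa A$ is stationary in $\mathcal P_\kappa A$ if it meets every club subset of $\mathcal P_\kappa A$. For a cardinal $\nu$ and an ordinal $\gamma$ let $\operatorname{cf}(\nu,\gamma)$ be the smallest size of an unbounded subset of $\mathcal P_\nu\gamma$. Stationary reflection for $\mathcal P_\kappa\lambda$ is the statement: for every stationary $S\subseteq\mathcal P_\kappa\lambda$ there is a set $A$ with $\kappa\subseteq A\subseteq\lambda$ and $|A|=\kappa$ such that $S\cap\mathcal P_\kappa A$ is stationary in $\mathcal P_\kappa A$. Theorem 2. Let $\nu<\kappa$ be regular uncountable cardinals such that $\operatorname{cf}(\nu,\gamma)<\kappa$ for all ordinals $\gamma$ with $\nu<\gamma<\kappa$. Then stationary reflection for $\mathcal P_\kappa\lambda$ fails for every cardinal $\lambda\ge\kappa^+$. Moreover, for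 regular uncountable cardinals $\nu<\kappa$, the condition that $\operatorname{cf}(\nu,\gamma)<\kappa$ for all ordinals $\nu<\gamma<\kappa$ holds if $\kappa=\nu^+$, and it holds if $\nu=\omega_1$ and $\gamma^{\omega}<\kappa$ for all cardinals $\gamma<\kappa$. -/

import Mathlib

universe u v

namespace PkReflection

/-- `𝒫_κ A`: the subsets of `A` of size `< κ`. -/
def Pk {α : Type v} (κ : Cardinal.{v}) (A : Set α) : Set (Set α) :=
  {x | x ⊆ A ∧ Cardinal.mk x < κ}

/-- `X` is an unbounded subset of `𝒫_κ A`. -/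
def IsUnboundedIn {α : Type v} (κ : Cardinal.{v}) (A : Set α) (X : Set (Set α)) : Prop :=
  X ⊆ Pk κ A ∧ ∀ x ∈ Pk κ A, ∃ y ∈ X, x ⊆ y

/-- `C` is a club subset of `𝒫_κ A`: unbounded, and closed under unions of nonempty
`⊆`-chains of size `< κ`. -/
def IsClubIn {α : Type v} (κ : Cardinal.{v}) (A : Set α) (C : Set (Set α)) : Prop :=
  IsUnboundedIn κ A C ∧
    ∀ D : Set (Set α), D ⊆ C → D.Nonempty → IsChain (· ⊆ ·) D → Cardinal.mk D < κ →
      ⋃₀ D ∈ C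

/-- `S` is a stationary subset of `𝒫_κ A`: it meets every club subset of `𝒫_κ A`. -/
def IsStationaryIn {α : Type v} (κ : Cardinal.{v}) (A : Set α) (S : Set (Set α)) : Prop :=
  S ⊆ Pk κ A ∧ ∀ C : Set (Set α), IsClubIn κ A C → (S ∩ C).Nonempty

/-- Least size of an unbounded subset of `𝒫_ν A`. -/
noncomputable def cfPk {α : Type v} (ν : Cardinal.{v}) (A : Set α) : Cardinal.{v} :=
  sInf {c | ∃ X : Set (Set α), IsUnboundedIn ν A X ∧ Cardinal.mk X = c}

/-- `cf(ν, γ) < κ` for all ordinals `γ` with `ν < γ < κ`. Ordinals are identified with the set of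
smaller ordinals, cardinals with initial ordinals. The `lift`s are only there because sets of
ordinals of universe `u` have their cardinality in universe `u + 1`. -/
def CfBelow (ν κ : Cardinal.{u}) : Prop :=
  ∀ γ : Ordinal.{u}, ν.ord < γ → γ < κ.ord →
    cfPk (Cardinal.lift.{u + 1} ν) (Set.Iio γ) < Cardinal.lift.{u + 1} κ

/-- Stationary reflection for `𝒫_κ l`: for every stationary subset `S` of `𝒫_κ l` there is
`κ ⊆ A ⊆ l` of size `κ` such that `S ∩ 𝒫_κ A` is stationary in `𝒫_κ A`. -/
def StationaryReflection (κ l : Cardinal.{u}) : Prop :=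
  ∀ S : Set (Set Ordinal.{u}),
    IsStationaryIn (Cardinal.lift.{u + 1} κ) (Set.Iio l.ord) S →
    ∃ A : Set Ordinal.{u}, Set.Iio κ.ord ⊆ A ∧ A ⊆ Set.Iio l.ord ∧
      Cardinal.mk A = Cardinal.lift.{u + 1} κ ∧
      IsStationaryIn (Cardinal.lift.{u + 1} κ) A (S ∩ Pk (Cardinal.lift.{u + 1} κ) A)

end PkReflection

namespace PkReflection

section ClosedSets

variable {α : Type v}

/-- `x` is closed under the set-valued operation `F` on finite sets. -/
def IsClosedUnder (F : Finset α → Set α) (x : Set α) : Prop :=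
  ∀ s : Finset α, (s : Set α) ⊆ x → F s ⊆ x

/-- The closure of `y` under `F`. -/
def hull (F : Finset α → Set α) (y : Set α) : Set α :=
  ⋂₀ {z | y ⊆ z ∧ IsClosedUnder F z}

theorem subset_hull (F : Finset α → Set α) (y : Set α) : y ⊆ hull F y :=
  Set.subset_sInter fun _ hz => hz.1

theorem isClosedUnder_hull (F : Finset α → Set α) (y : Set α) : IsClosedUnder F (hull F y) :=
  fun s hs => Set.subset_sInter fun _ hz => hz.2 s (hs.trans (Set.sInter_subset_of_mem hz))

theorem hull_subset {F : Finset α → Set α} {y z : Set α} (hy : y ⊆ z) (hz : IsClosedUnder F z) :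
    hull F y ⊆ z :=
  Set.sInter_subset_of_mem ⟨hy, hz⟩

theorem hull_mono (F : Finset α → Set α) {y z : Set α} (h : y ⊆ z) : hull F y ⊆ hull F z :=
  hull_subset (h.trans (subset_hull F z)) (isClosedUnder_hull F z)

theorem exists_finset_subset_of_directed {ι : Type*} [Nonempty ι] {y : ι → Set α}
    (hy : Directed (· ⊆ ·) y) (s : Finset α) (hs : (s : Set α) ⊆ ⋃ j, y j) :
    ∃ j, (s : Set α) ⊆ y j := by
  classical
  induction s using Finset.induction_on with
  | empty => exact ⟨Classical.arbitrary ι, by simp⟩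
  | insert a s _ ih =>
    rw [Finset.coe_insert, Set.insert_subset_iff] at hs
    obtain ⟨j, hj⟩ := ih hs.2
    obtain ⟨k, hk⟩ := Set.mem_iUnion.1 hs.1
    obtain ⟨m, h1, h2⟩ := hy j k
    refine ⟨m, ?_⟩
    rw [Finset.coe_insert, Set.insert_subset_iff]
    exact ⟨h2 hk, hj.trans h1⟩

theorem IsClosedUnder.iUnion_of_directed {F : Finset α → Set α} {ι : Type*} [Nonempty ι]
    {y : ι → Set α} (hd : Directed (· ⊆ ·) y) (hy : ∀ j, IsClosedUnder F (y j)) :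
    IsClosedUnder F (⋃ j, y j) := by
  intro s hs
  obtain ⟨j, hj⟩ := exists_finset_subset_of_directed hd s hs
  exact (hy j s hj).trans (Set.subset_iUnion y j)

theorem hull_iUnion_subset {F : Finset α → Set α} {ι : Type*} [Nonempty ι]
    {y : ι → Set α} (hd : Directed (· ⊆ ·) y) : hull F (⋃ j, y j) ⊆ ⋃ j, hull F (y j) := by
  refine hull_subset (Set.iUnion_mono fun j => subset_hull F _)
    (IsClosedUnder.iUnion_of_directed (fun i j => ?_) fun j => isClosedUnder_hull F _)
  obtain ⟨m, h1, h2⟩ := hd i j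
  exact ⟨m, hull_mono F h1, hull_mono F h2⟩

end ClosedSets

section Cardinality

open Cardinal

variable {α : Type v} {K : Cardinal.{v}}

theorem mk_finset_lt (hK : ℵ₀ < K) {y : Set α} (hy : #y < K) : #(Finset y) < K := by
  rcases finite_or_infinite y with h | h
  · exact (lt_aleph0_of_finite _).trans hK
  · rwa [mk_finset_of_infinite]

theorem mk_iUnion_lt (hK : K.IsRegular) {ι : Type v} {t : ι → Set α} (hι : #ι < K)
    (ht : ∀ j, #(t j) < K) : #(⋃ j, t j : Set α) < K :=
  (card_iUnion_lt_iff_forall_of_isRegular hK hι).2 ht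

theorem mk_iUnion_nat_lt (hK : K.IsRegular) (hK' : ℵ₀ < K) {t : ℕ → Set α}
    (ht : ∀ j, #(t j) < K) : #(⋃ j, t j : Set α) < K := by
  have : (⋃ j, t j) = ⋃ j : ULift.{v} ℕ, t j.down := by ext; simp
  rw [this]
  exact mk_iUnion_lt hK (by simpa using hK') fun j => ht _

theorem mk_union_lt (hK : ℵ₀ < K) {x y : Set α} (hx : #x < K) (hy : #y < K) :
    #(x ∪ y : Set α) < K :=
  (mk_union_le x y).trans_lt (add_lt_of_lt hK.le hx hy)

theorem mk_hull_lt (hK : K.IsRegular) (hK' : ℵ₀ < K) {F : Finset α → Set α}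
    (hF : ∀ s, #(F s) < K) {y : Set α} (hy : #y < K) : #(hull F y) < K := by
  classical
  let step : Set α → Set α := fun z => z ∪ ⋃ s : Finset z, F (s.map (Function.Embedding.subtype _))
  let t : ℕ → Set α := fun n => step^[n] y
  have ht : ∀ n, t (n + 1) = step (t n) := fun n => Function.iterate_succ_apply' _ _ _
  have hmono : Monotone t := monotone_nat_of_le_succ fun n => by
    rw [ht]; exact Set.subset_union_left
  have hcard : ∀ n, #(t n) < K := by
    intro n
    induction n with
    | zero => exact hy
    | succ n ih =>
      rw [ht]
      exact mk_union_lt hK' ih (mk_iUnion_lt hK (mk_finset_lt hK' ih) fun s => hF _)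
  refine (mk_le_mk_of_subset (hull_subset (z := ⋃ n, t n) (Set.subset_iUnion t 0) ?_)).trans_lt
    (mk_iUnion_nat_lt hK hK' hcard)
  intro s hs
  obtain ⟨n, hn⟩ := exists_finset_subset_of_directed hmono.directed_le s hs
  refine Set.Subset.trans ?_ (Set.subset_iUnion t (n + 1))
  rw [ht]
  refine Set.Subset.trans ?_ Set.subset_union_right
  refine Set.Subset.trans ?_ (Set.subset_iUnion _ (s.subtype (· ∈ t n)))
  rw [Finset.subtype_map_of_mem fun x hx => hn hx]

/-- The closure points of a set-valued operation form a club. -/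
theorem isClubIn_setOf_isClosedUnder (hK : K.IsRegular) (hK' : ℵ₀ < K) {A : Set α}
    {F : Finset α → Set α} (hF : ∀ s, #(F s) < K) (hFA : ∀ s : Finset α, (s : Set α) ⊆ A → F s ⊆ A) :
    IsClubIn K A {x | x ∈ Pk K A ∧ IsClosedUnder F x} := by
  refine ⟨⟨fun x hx => hx.1, fun x hx => ⟨hull F x, ⟨⟨hull_subset hx.1 hFA,
    mk_hull_lt hK hK' hF hx.2⟩, isClosedUnder_hull F x⟩, subset_hull F x⟩⟩, ?_⟩
  intro D hD hne hchain hDK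
  have : Nonempty D := hne.to_subtype
  rw [Set.sUnion_eq_iUnion]
  refine ⟨⟨Set.iUnion_subset fun x => (hD x.2).1.1,
    mk_iUnion_lt hK hDK fun x => (hD x.2).1.2⟩, ?_⟩
  exact IsClosedUnder.iUnion_of_directed (directedOn_iff_directed.1 hchain.directedOn)
    fun x => (hD x.2).2

theorem isClubIn_cone (hK : K.IsRegular) (hK' : ℵ₀ < K) {A y : Set α} (hy : y ∈ Pk K A) :
    IsClubIn K A {x | x ∈ Pk K A ∧ y ⊆ x} := by
  have := isClubIn_setOf_isClosedUnder hK hK' (A := A) (F := fun _ => y) (fun _ => hy.2)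
    (fun _ _ => hy.1)
  convert this using 4
  exact ⟨fun h s _ => h, fun h => h ∅ (by simp)⟩

/-- A monotone choice of supersets, indexed by finite sets. -/
noncomputable def finsetTower (φ : Set α → Set α) (s : Finset α) : Set α :=
  φ (↑s ∪ ⋃ t : {t : Finset α // t ⊂ s}, finsetTower φ t.1)
termination_by s.card
decreasing_by exact Finset.card_lt_card t.2

theorem exists_monotone_finset_to_club (hK : K.IsRegular) (hK' : ℵ₀ < K) {A : Set α}
    {C : Set (Set α)} (hC : IsClubIn K A C) :
    ∃ F : Finset α → Set α, ∀ s : Finset α, (s : Set α) ⊆ A →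
      F s ∈ C ∧ ↑s ⊆ F s ∧ ∀ t ⊆ s, F t ⊆ F s := by
  classical
  choose! φ hφC hφ using hC.1.2
  refine ⟨finsetTower φ, fun s => ?_⟩
  induction s using Finset.strongInduction with
  | H s ih =>
    intro hs
    have hmem : (↑s ∪ ⋃ t : {t : Finset α // t ⊂ s}, finsetTower φ t.1 : Set α) ∈ Pk K A := by
      have hC' : ∀ t : {t : Finset α // t ⊂ s}, finsetTower φ t.1 ∈ Pk K A := fun t =>
        hC.1.1 (ih t.1 t.2 ((Finset.coe_subset.2 t.2.1).trans hs)).1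
      refine ⟨Set.union_subset hs (Set.iUnion_subset fun t => (hC' t).1), ?_⟩
      refine mk_union_lt hK' ((lt_aleph0_of_finite _).trans hK') (mk_iUnion_lt hK ?_
        fun t => (hC' t).2)
      have : Finite {t : Finset α // t ⊂ s} := by
        refine Finite.of_injective (β := s.powerset)
          (fun t => ⟨t.1, Finset.mem_powerset.2 t.2.1⟩) fun a b h => ?_
        simpa [Subtype.ext_iff] using h
      exact (lt_aleph0_of_finite _).trans hK'
    have hsub := hφ _ hmem
    rw [finsetTower]
    refine ⟨hφC _ hmem, Set.subset_union_left.trans hsub, fun t ht => ?_⟩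
    rcases ht.eq_or_ssubset with rfl | h
    · rw [finsetTower]
    · exact ((Set.subset_iUnion (fun t : {t : Finset α // t ⊂ s} => finsetTower φ t.1)
        ⟨t, h⟩).trans Set.subset_union_right).trans hsub

/-- A club is closed under the unions of monotone families indexed by the finite subsets of a
small set. -/
theorem IsClubIn.iUnion_finset_mem {A : Set α} {C : Set (Set α)}
    (hC : IsClubIn K A C) {F : Finset α → Set α}
    (hF : ∀ s : Finset α, (s : Set α) ⊆ A → F s ∈ C ∧ ↑s ⊆ F s ∧ ∀ t ⊆ s, F t ⊆ F s)
    (y : Set α) (hy : y ∈ Pk K A) : (⋃ s : {s : Finset α // (s : Set α) ⊆ y}, F s.1) ∈ C := by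
  classical
  obtain ⟨c, hc⟩ : ∃ c, c = #y := ⟨_, rfl⟩
  induction c using WellFoundedLT.induction generalizing y with
  | ind c ih =>
  rcases Set.finite_or_infinite y with hfin | hinf
  · have : (⋃ s : {s : Finset α // (s : Set α) ⊆ y}, F s.1) = F hfin.toFinset := by
      apply Set.Subset.antisymm
      · refine Set.iUnion_subset fun s => (hF hfin.toFinset (by simpa using hy.1)).2.2 _ ?_
        intro a ha
        simpa using s.2 ha
      · exact Set.subset_iUnion (fun s : {s : Finset α // (s : Set α) ⊆ y} => F s.1)
          ⟨hfin.toFinset, by simp⟩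
    rw [this]
    exact (hF _ (by simpa using hy.1)).1
  · have : Infinite y := hinf.to_subtype
    obtain ⟨r, hr, hord⟩ := exists_ord_eq y
    let Y : y → Set α := fun a => (↑) '' {b : y | r b a ∨ b = a}
    have hYy : ∀ a, Y a ⊆ y := by rintro a _ ⟨b, _, rfl⟩; exact b.2
    have hYcard : ∀ a, #(Y a) < #y := by
      intro a
      refine mk_image_le.trans_lt ?_
      refine (mk_union_le {b : y | r b a} {a}).trans_lt ?_
      refine add_lt_of_lt (aleph0_le_mk _) ?_ (by simpa using (one_lt_aleph0.trans_le (aleph0_le_mk y)))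
      have := card_typein_lt (r := r) a hord
      rwa [Ordinal.card_typein] at this
    have hYmono : ∀ a b, r a b → Y a ⊆ Y b := by
      rintro a b hab _ ⟨d, hd, rfl⟩
      refine ⟨d, Or.inl ?_, rfl⟩
      rcases hd with hd | rfl
      · exact _root_.trans hd hab
      · exact hab
    let G : Set α → Set α := fun z => ⋃ s : {s : Finset α // (s : Set α) ⊆ z}, F s.1
    have hGmono : ∀ z w, z ⊆ w → G z ⊆ G w := fun z w h => Set.iUnion_subset fun s =>
      Set.subset_iUnion (fun s : {s : Finset α // (s : Set α) ⊆ w} => F s.1) ⟨s.1, s.2.trans h⟩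
    have hGC : ∀ a, G (Y a) ∈ C := fun a =>
      ih #(Y a) (hc ▸ hYcard a) (Y a) ⟨(hYy a).trans hy.1, (hYcard a).trans hy.2⟩ rfl
    have hdir : Directed (· ⊆ ·) Y := by
      intro a b
      rcases trichotomous_of r a b with h | rfl | h
      · exact ⟨b, hYmono _ _ h, subset_rfl⟩
      · exact ⟨a, subset_rfl, subset_rfl⟩
      · exact ⟨a, subset_rfl, hYmono _ _ h⟩
    have hunion : G y = ⋃₀ Set.range fun a => G (Y a) := by
      rw [Set.sUnion_range]
      apply Set.Subset.antisymm
      · refine Set.iUnion_subset fun s => ?_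
        obtain ⟨a, ha⟩ := exists_finset_subset_of_directed hdir s.1 fun b hb =>
          Set.mem_iUnion.2 ⟨⟨b, s.2 hb⟩, ⟨b, s.2 hb⟩, Or.inr rfl, rfl⟩
        exact (Set.subset_iUnion (fun s : {s : Finset α // (s : Set α) ⊆ Y a} => F s.1)
          ⟨s.1, ha⟩).trans (Set.subset_iUnion (fun a => G (Y a)) a)
      · exact Set.iUnion_subset fun a => hGmono _ _ (hYy a)
    change G y ∈ C
    rw [hunion]
    refine hC.2 _ ?_ (Set.range_nonempty _) ?_ (mk_range_le.trans_lt hy.2)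
    · rintro _ ⟨a, rfl⟩
      exact hGC a
    · rintro _ ⟨a, rfl⟩ _ ⟨b, rfl⟩ _
      rcases trichotomous_of r a b with h | rfl | h
      · exact Or.inl (hGmono _ _ (hYmono _ _ h))
      · exact Or.inl subset_rfl
      · exact Or.inr (hGmono _ _ (hYmono _ _ h))

/-- Every club contains all small sets closed under a suitable set-valued operation on finite
sets. -/
theorem IsClubIn.exists_isClosedUnder (hK : K.IsRegular) (hK' : ℵ₀ < K) {A : Set α}
    {C : Set (Set α)} (hC : IsClubIn K A C) :
    ∃ F : Finset α → Set α, (∀ s, F s ∈ Pk K A) ∧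
      ∀ x ∈ Pk K A, IsClosedUnder F x → x ∈ C := by
  classical
  obtain ⟨F, hF⟩ := exists_monotone_finset_to_club hK hK' hC
  refine ⟨fun s => if (s : Set α) ⊆ A then F s else ∅, fun s => ?_, fun x hx hcl => ?_⟩
  · dsimp only
    split_ifs with h
    · exact hC.1.1 (hF s h).1
    · exact ⟨Set.empty_subset _, by simpa using hK.pos⟩
  · have : x = ⋃ s : {s : Finset α // (s : Set α) ⊆ x}, F s.1 := by
      apply Set.Subset.antisymm
      · intro a ha
        have ha' : (({a} : Finset α) : Set α) ⊆ x := by simpa using ha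
        refine Set.mem_iUnion.2 ⟨⟨{a}, ha'⟩, (hF {a} (ha'.trans hx.1)).2.1 (by simp)⟩
      · refine Set.iUnion_subset fun s => ?_
        simpa only [if_pos (s.2.trans hx.1)] using hcl s.1 s.2
    rw [this]
    exact hC.iUnion_finset_mem hF x hx

end Cardinality

open Cardinal Ordinal Set

section Ordinals

theorem mk_Iio_ord (μ : Cardinal.{u}) : #(Iio μ.ord) = lift.{u + 1} μ := by simp

theorem exists_lt_ord_forall_lt {μ : Cardinal.{u}} (hμ : μ.IsRegular) {B : Set Ordinal.{u}}
    (hB : B ⊆ Iio μ.ord) (hc : #B < lift.{u + 1} μ) : ∃ b < μ.ord, ∀ β ∈ B, β < b := by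
  refine ⟨sSup ((· + 1) '' B), sSup_add_one_lt_of_lt_cof ?_ hB, fun β hβ => ?_⟩
  · rwa [Cardinal.lift_ord, hμ.lift.cof_ord]
  · have hbdd : BddAbove ((· + 1) '' B) := by
      refine ⟨μ.ord, ?_⟩
      rintro _ ⟨γ, hγ, rfl⟩
      exact Order.add_one_le_of_lt (hB hγ)
    exact Order.add_one_le_iff.1 (le_csSup hbdd ⟨β, hβ, rfl⟩)

/-- `δ` has a cofinal sequence of length `ω` (cofinality `1` is allowed). -/
def HasOmegaSeq (δ : Ordinal.{u}) : Prop :=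
  ∃ s : ℕ → Ordinal.{u}, (∀ n, s n < δ) ∧ ∀ ξ < δ, ∃ n, ξ ≤ s n

theorem exists_omega_ladder :
    ∃ c : Ordinal.{u} → Set Ordinal.{u}, ∀ δ, HasOmegaSeq δ →
      c δ ⊆ Iio δ ∧ (c δ).Countable ∧ ∀ ξ < δ, ∃ γ ∈ c δ, ξ ≤ γ := by
  choose! s hs hs' using fun (δ : Ordinal.{u}) (h : HasOmegaSeq δ) => h
  refine ⟨fun δ => range (s δ), fun δ hδ => ⟨?_, countable_range _, fun ξ hξ => ?_⟩⟩
  · rintro _ ⟨n, rfl⟩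
    exact hs δ hδ n
  · obtain ⟨n, hn⟩ := hs' δ hδ ξ hξ
    exact ⟨_, ⟨n, rfl⟩, hn⟩

/-- Injections of the ordinals below `κ⁺` into `κ`, with left inverses. -/
theorem exists_injections (κ : Cardinal.{u}) :
    ∃ g f : Ordinal.{u} → Ordinal.{u} → Ordinal.{u}, ∀ α < (Order.succ κ).ord, ∀ β < α,
      g α β < κ.ord ∧ f α (g α β) = β := by
  have : ∀ α : Ordinal.{u}, ∃ g f : Ordinal.{u} → Ordinal.{u}, α < (Order.succ κ).ord →
      ∀ β < α, g β < κ.ord ∧ f (g β) = β := by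
    intro α
    by_cases hα : α < (Order.succ κ).ord
    · have hle : #(Iio α) ≤ #(Iio κ.ord) := by
        rw [mk_Iio_ord, Cardinal.mk_Iio_ordinal, Cardinal.lift_le]
        exact Order.lt_succ_iff.1 (lt_ord.1 hα)
      obtain ⟨e⟩ := hle
      classical
      let g : Ordinal.{u} → Ordinal.{u} := fun β => if h : β < α then e ⟨β, h⟩ else 0
      have hg : InjOn g (Iio α) := by
        intro a ha b hb hab
        simp only [g, dif_pos (mem_Iio.1 ha), dif_pos (mem_Iio.1 hb)] at hab
        exact Subtype.ext_iff.1 (e.injective (Subtype.ext hab))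
      refine ⟨g, Function.invFunOn g (Iio α), fun _ β hβ => ⟨?_, hg.leftInvOn_invFunOn hβ⟩⟩
      simp only [g, dif_pos hβ]
      exact (e ⟨β, hβ⟩).2
    · exact ⟨id, id, fun h => absurd h hα⟩
  choose g f h using this
  exact ⟨g, f, fun α hα => h α hα⟩

/-- Transfinite iteration of `m`, made strictly increasing. -/
noncomputable def iterBound (m : Ordinal.{u} → Ordinal.{u}) (ξ : Ordinal.{u}) : Ordinal.{u} :=
  ⨆ η : Iio ξ, (max (iterBound m η.1) (m (iterBound m η.1)) + 1)
termination_by ξ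
decreasing_by exact η.2

theorem lt_iterBound_iff {m : Ordinal.{u} → Ordinal.{u}} {ξ a : Ordinal.{u}} :
    a < iterBound m ξ ↔ ∃ η < ξ, a ≤ max (iterBound m η) (m (iterBound m η)) := by
  rw [iterBound, Ordinal.lt_iSup_iff]
  simp [Order.lt_add_one_iff]

theorem iterBound_lt_iterBound {m : Ordinal.{u} → Ordinal.{u}} {ξ η : Ordinal.{u}} (h : η < ξ) :
    iterBound m η < iterBound m ξ :=
  lt_iterBound_iff.2 ⟨η, h, le_max_left _ _⟩

theorem iterBound_lt_ord {κ : Cardinal.{u}} (hκ : κ.IsRegular) {m : Ordinal.{u} → Ordinal.{u}}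
    (hm : ∀ j < κ.ord, m j < κ.ord) (ξ : Ordinal.{u}) (hξ : ξ < κ.ord) :
    iterBound m ξ < κ.ord := by
  induction ξ using WellFoundedLT.induction with
  | ind ξ ih =>
  obtain ⟨b, hb, hlt⟩ := exists_lt_ord_forall_lt hκ
    (B := (fun η => max (iterBound m η) (m (iterBound m η))) '' Iio ξ) (by
      rintro _ ⟨η, hη, rfl⟩
      have := ih η hη (lt_trans hη hξ)
      exact max_lt this (hm _ this)) (mk_image_le.trans_lt (by
        rw [Cardinal.mk_Iio_ordinal, Cardinal.lift_lt]; exact lt_ord.1 hξ))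
  refine lt_of_le_of_lt (not_lt.1 fun h => ?_) hb
  obtain ⟨η, hη, hle⟩ := lt_iterBound_iff.1 h
  exact (hlt _ ⟨η, hη, rfl⟩).not_ge hle

theorem not_hasOmegaSeq_iterBound (m : Ordinal.{u} → Ordinal.{u}) :
    ¬ HasOmegaSeq (iterBound m (ℵ_ (1 : Ordinal.{u})).ord) := by
  rintro ⟨s, hs, hcof⟩
  choose η hη hle using fun n => lt_iterBound_iff.1 (hs n)
  obtain ⟨b, hb, hlt⟩ := exists_lt_ord_forall_lt isRegular_aleph_one (B := range η) (by
    rintro _ ⟨n, rfl⟩; exact hη n) (by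
      refine ((countable_range η).le_aleph0).trans_lt ?_
      rw [← Cardinal.lift_aleph0.{u + 1, u}, Cardinal.lift_lt]
      exact aleph0_lt_aleph_one)
  obtain ⟨n, hn⟩ := hcof _ (iterBound_lt_iterBound (m := m) hb)
  exact ((lt_iterBound_iff.2 ⟨η n, hlt _ ⟨n, rfl⟩, hle n⟩).trans_le hn).false

/-- There is a level of uncountable cofinality at which the hull adds no ordinal below `κ`. -/
theorem exists_hull_Iio_inter_subset {κ : Cardinal.{u}} (hκ : κ.IsRegular)
    (hκ₁ : ℵ_ (1 : Ordinal.{u}) < κ) {F : Finset Ordinal.{u} → Set Ordinal.{u}}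
    (hF : ∀ s, #(F s) < lift.{u + 1} κ) :
    ∃ i < κ.ord, ¬ HasOmegaSeq i ∧ hull F (Iio i) ∩ Iio κ.ord ⊆ Iio i := by
  have hK : ℵ₀ < lift.{u + 1} κ := by
    rw [← Cardinal.lift_aleph0.{u + 1, u}, Cardinal.lift_lt]
    exact aleph0_lt_aleph_one.trans hκ₁
  have : ∀ j < κ.ord, ∃ b < κ.ord, ∀ β ∈ hull F (Iio j) ∩ Iio κ.ord, β < b := by
    intro j hj
    refine exists_lt_ord_forall_lt hκ inter_subset_right ?_
    refine (mk_le_mk_of_subset inter_subset_left).trans_lt (mk_hull_lt hκ.lift hK hF ?_)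
    rw [Cardinal.mk_Iio_ordinal, Cardinal.lift_lt]
    exact lt_ord.1 hj
  choose! m hm hm' using this
  have hΩ : (ℵ_ (1 : Ordinal.{u})).ord < κ.ord := ord_lt_ord.2 hκ₁
  refine ⟨iterBound m (ℵ_ (1 : Ordinal.{u})).ord, iterBound_lt_ord hκ hm _ hΩ,
    not_hasOmegaSeq_iterBound m, ?_⟩
  set Ω := (ℵ_ (1 : Ordinal.{u})).ord with hΩdef
  have hlim : Order.IsSuccLimit Ω := isSuccLimit_ord aleph0_lt_aleph_one.le
  have hne : Nonempty (Iio Ω) := ⟨⟨0, hlim.bot_lt⟩⟩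
  have hunion : Iio (iterBound m Ω) ⊆ ⋃ η : Iio Ω, Iio (iterBound m η.1) := by
    intro a ha
    obtain ⟨η, hη, hle⟩ := lt_iterBound_iff.1 ha
    exact mem_iUnion.2 ⟨⟨η + 1, hlim.add_one_lt hη⟩,
      lt_iterBound_iff.2 ⟨η, Order.lt_add_one_iff.2 le_rfl, hle⟩⟩
  have hdir : Directed (· ⊆ ·) fun η : Iio Ω => Iio (iterBound m η.1) := by
    refine Monotone.directed_le fun a b hab => ?_
    rcases hab.eq_or_lt with rfl | h
    · exact le_rfl
    · exact Iio_subset_Iio (iterBound_lt_iterBound h).le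
  rintro ξ ⟨hξ, hξκ⟩
  obtain ⟨η, hη⟩ := mem_iUnion.1 (hull_iUnion_subset hdir (hull_mono F hunion hξ))
  have hηκ : iterBound m η.1 < κ.ord := iterBound_lt_ord hκ hm _ (lt_trans η.2 hΩ)
  exact lt_iterBound_iff.2 ⟨η.1, η.2, (hm' _ hηκ ξ ⟨hη, hξκ⟩).le.trans (le_max_right _ _)⟩

end Ordinals

section Game

/-- The second player of the game of extending `s` by ordinals below `p`, exceeding bounds
prescribed by the first player, while keeping `P` true, loses `s` with rank at most `ζ`. -/
inductive LosesAt (p : Ordinal.{u}) (P : Finset Ordinal.{u} → Prop) :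
    Ordinal.{u + 1} → Finset Ordinal.{u} → Prop
  | bad {ζ : Ordinal.{u + 1}} {s : Finset Ordinal.{u}} (h : ¬ P s) : LosesAt p P ζ s
  | step {ζ : Ordinal.{u + 1}} {s : Finset Ordinal.{u}} (α : Ordinal.{u}) (hα : α < p)
      (r : Ordinal.{u} → Ordinal.{u + 1}) (hr : ∀ β, α < β → β < p → r β < ζ)
      (h : ∀ β, α < β → β < p → LosesAt p P (r β) (insert β s)) : LosesAt p P ζ s

/-- The second player does not lose from `s`. -/
def Survives (p : Ordinal.{u}) (P : Finset Ordinal.{u} → Prop) (s : Finset Ordinal.{u}) : Prop :=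
  ∀ ζ, ¬ LosesAt p P ζ s

variable {p : Ordinal.{u}} {P : Finset Ordinal.{u} → Prop} {s : Finset Ordinal.{u}}

theorem Survives.prop (h : Survives p P s) : P s :=
  by_contra fun hP => h 0 (.bad hP)

theorem Survives.exists_insert (h : Survives p P s) {α : Ordinal.{u}} (hα : α < p) :
    ∃ β, α < β ∧ β < p ∧ Survives p P (insert β s) := by
  by_contra! hno
  have : ∀ β, ∃ ζ, α < β → β < p → LosesAt p P ζ (insert β s) := by
    intro β
    by_cases hβ : α < β ∧ β < p
    · have := hno β hβ.1 hβ.2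
      simp only [Survives, not_forall, not_not] at this
      exact this.imp fun ζ hζ _ _ => hζ
    · exact ⟨0, fun h1 h2 => absurd ⟨h1, h2⟩ hβ⟩
  choose r hr using this
  exact h (⨆ β, (r β + 1)) (.step α hα r
    (fun β _ _ => Order.add_one_le_iff.1 (Ordinal.le_iSup (fun β => r β + 1) β)) hr)

/-- The first player has a strategy that wins every lost position; a set in which the second
player can answer this strategy consists of positions that are not lost. -/
theorem exists_strategy (hp : 0 < p) (P : Finset Ordinal.{u} → Prop) :
    ∃ τ : Finset Ordinal.{u} → Ordinal.{u}, (∀ s, τ s < p) ∧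
      ∀ M : Set Ordinal.{u}, (∀ s : Finset Ordinal.{u}, (s : Set _) ⊆ M → P s) →
        (∀ s : Finset Ordinal.{u}, (s : Set _) ⊆ M → ∃ β ∈ M, τ s < β ∧ β < p) →
        ∀ s : Finset Ordinal.{u}, (s : Set _) ⊆ M → Survives p P s := by
  have : ∀ s, ∃ α < p, ∀ ζ, LosesAt p P ζ s → P s → ∀ β, α < β → β < p →
      ∃ ζ' < ζ, LosesAt p P ζ' (insert β s) := by
    intro s
    by_cases hs : P s ∧ ∃ ζ, LosesAt p P ζ s
    · obtain ⟨hPs, hex⟩ := hs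
      obtain ⟨ζ₀, h₀, hmin⟩ := WellFounded.has_min (wellFounded_lt) {ζ | LosesAt p P ζ s} hex
      cases h₀ with
      | bad h => exact absurd hPs h
      | step α hα r hr h =>
        refine ⟨α, hα, fun ζ hζ _ β h1 h2 => ⟨r β, ?_, h β h1 h2⟩⟩
        exact (hr β h1 h2).trans_le (not_lt.1 (hmin ζ hζ))
    · exact ⟨0, hp, fun ζ hζ hPs => absurd ⟨hPs, ζ, hζ⟩ hs⟩
  choose τ hτ hτ' using this
  refine ⟨τ, hτ, fun M hP hM s hs ζ => ?_⟩
  induction ζ using WellFoundedLT.induction generalizing s with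
  | ind ζ ih =>
  intro hζ
  obtain ⟨β, hβM, h1, h2⟩ := hM s hs
  obtain ⟨ζ', hlt, h'⟩ := hτ' s ζ hζ (hP s hs) β h1 h2
  refine ih ζ' hlt (insert β s) ?_ h'
  rw [Finset.coe_insert, insert_subset_iff]
  exact ⟨hβM, hs⟩

end Game

section LadderSet

/-- `x ∩ κ` is the ordinal `i`, and `x ∩ α` is determined by `i` for `α ∈ x` below `κ⁺`. -/
structure IsCoherent (κ : Cardinal.{u}) (g : Ordinal.{u} → Ordinal.{u} → Ordinal.{u})
    (x : Set Ordinal.{u}) (i : Ordinal.{u}) : Prop where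
  lt : i < κ.ord
  mem_iff : ∀ ξ < κ.ord, ξ ∈ x ↔ ξ < i
  initial : ∀ α ∈ x, α < (Order.succ κ).ord → ∀ β < α, (β ∈ x ↔ g α β < i)

/-- `δ` is the supremum, not attained, of `x ∩ p`. -/
structure IsSupBelow (p : Ordinal.{u}) (x : Set Ordinal.{u}) (δ : Ordinal.{u}) : Prop where
  lt : ∀ α ∈ x, α < p → α < δ
  cofinal : ∀ α < δ, ∃ β ∈ x, β < p ∧ α ≤ β

/-- The coherent sets whose supremum below `κ⁺` has countable cofinality while their trace on `κ`
does not, and which do not contain the ladder `c δ` at their supremum `δ`. -/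
def ladderSet (κ l : Cardinal.{u}) (g : Ordinal.{u} → Ordinal.{u} → Ordinal.{u})
    (c : Ordinal.{u} → Set Ordinal.{u}) : Set (Set Ordinal.{u}) :=
  {x | x ∈ Pk (lift.{u + 1} κ) (Iio l.ord) ∧ ∃ i δ, IsCoherent κ g x i ∧
    IsSupBelow (Order.succ κ).ord x δ ∧ HasOmegaSeq δ ∧ ¬ HasOmegaSeq i ∧ ¬ c δ ⊆ x}

variable {κ l : Cardinal.{u}} {g : Ordinal.{u} → Ordinal.{u} → Ordinal.{u}}
  {c : Ordinal.{u} → Set Ordinal.{u}} {x A : Set Ordinal.{u}} {i δ : Ordinal.{u}}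

theorem IsStationaryIn.exists_superset {K : Cardinal.{v}} {α : Type v} (hK : K.IsRegular)
    (hK' : ℵ₀ < K) {A : Set α} {S : Set (Set α)} (hS : IsStationaryIn K A S) {y : Set α}
    (hy : y ∈ Pk K A) : ∃ x ∈ S, x ∈ Pk K A ∧ y ⊆ x := by
  obtain ⟨x, hxS, hx⟩ := hS.2 _ (isClubIn_cone hK hK' hy)
  exact ⟨x, hxS, hx⟩

theorem IsSupBelow.eq_of_subset {p : Ordinal.{u}} {δ' : Ordinal.{u}} (h : IsSupBelow p x δ')
    (hx : ∀ α ∈ x, α < p → α < δ) (hδ : δ < p) {d : Set Ordinal.{u}} (hd : d ⊆ Iio δ)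
    (hd' : ∀ ξ < δ, ∃ γ ∈ d, ξ ≤ γ) (hdx : d ⊆ x) : δ' = δ := by
  apply le_antisymm
  · by_contra! hlt
    obtain ⟨β, hβ, hβp, hle⟩ := h.cofinal δ hlt
    exact (hx β hβ hβp).not_ge hle
  · by_contra! hlt
    obtain ⟨γ, hγ, hle⟩ := hd' δ' hlt
    exact (h.lt γ (hdx hγ) ((hd hγ).trans hδ)).not_ge hle

/-- If stationarily many subsets of `A` are coherent, then `A` is an initial segment below `κ⁺`. -/
theorem exists_inter_Iio_eq (hκ : κ.IsRegular) (hκ' : ℵ₀ < lift.{u + 1} κ)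
    (hg : ∀ α < (Order.succ κ).ord, ∀ β < α, g α β < κ.ord)
    (hκA : Iio κ.ord ⊆ A) (hA : #A = lift.{u + 1} κ)
    (hst : IsStationaryIn (lift.{u + 1} κ) A
      (ladderSet κ l g c ∩ Pk (lift.{u + 1} κ) A)) :
    ∃ δ < (Order.succ κ).ord, ∀ α < (Order.succ κ).ord, (α ∈ A ↔ α < δ) := by
  have hdown : ∀ α ∈ A, α < (Order.succ κ).ord → ∀ β < α, β ∈ A := by
    intro α hα hαp β hβ
    have hξ := hg α hαp β hβ
    obtain ⟨x, ⟨⟨_, i, δ, hco, _⟩, hxA⟩, _, hsub⟩ := hst.exists_superset hκ.lift hκ'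
      (y := {α, g α β}) ⟨by rintro _ (rfl | rfl); exacts [hα, hκA hξ],
        (lt_aleph0_of_finite _).trans hκ'⟩
    refine hxA.1 ((hco.initial α (hsub (by simp)) hαp β hβ).2 ?_)
    exact (hco.mem_iff _ hξ).1 (hsub (by simp))
  have hex : ({α | α ∈ A ∧ α < (Order.succ κ).ord}ᶜ).Nonempty :=
    ⟨(Order.succ κ).ord, fun h => lt_irrefl _ h.2⟩
  set δ := sInf ({α | α ∈ A ∧ α < (Order.succ κ).ord}ᶜ) with hδ
  have hδmem := csInf_mem hex
  have hlt : ∀ α < δ, α ∈ A ∧ α < (Order.succ κ).ord := fun α hα =>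
    not_not.1 (notMem_of_lt_csInf' hα)
  have hδp : δ < (Order.succ κ).ord := by
    by_contra! h
    have := mk_le_mk_of_subset (fun α hα => (hlt α (lt_of_lt_of_le hα h)).1 :
      Iio (Order.succ κ).ord ⊆ A)
    rw [mk_Iio_ord, hA, Cardinal.lift_le] at this
    exact (Order.lt_succ κ).not_ge this
  refine ⟨δ, hδp, fun α hα => ⟨fun h => ?_, fun h => (hlt α h).1⟩⟩
  by_contra! hle
  apply hδmem
  refine ⟨?_, hδp⟩
  rcases hle.eq_or_lt with h' | h'
  · rwa [← hδ, h']
  · exact hdown α h hα _ h'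

theorem not_isStationaryIn_ladderSet (hκ : κ.IsRegular) (hκ' : ℵ₀ < lift.{u + 1} κ)
    (hg : ∀ α < (Order.succ κ).ord, ∀ β < α, g α β < κ.ord)
    (hg' : ∀ α < (Order.succ κ).ord, InjOn (g α) (Iio α))
    (hc : ∀ δ, HasOmegaSeq δ → c δ ⊆ Iio δ ∧ (c δ).Countable ∧ ∀ ξ < δ, ∃ γ ∈ c δ, ξ ≤ γ)
    (hκA : Iio κ.ord ⊆ A) (hA : #A = lift.{u + 1} κ) :
    ¬ IsStationaryIn (lift.{u + 1} κ) A (ladderSet κ l g c ∩ Pk (lift.{u + 1} κ) A) := by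
  intro hst
  obtain ⟨δ, hδp, hAδ⟩ := exists_inter_Iio_eq hκ hκ' hg hκA hA hst
  have hsubA : Iio δ ⊆ A := fun α hα => (hAδ α (lt_trans hα hδp)).2 hα
  have hkp : κ.ord < (Order.succ κ).ord := ord_lt_ord.2 (Order.lt_succ κ)
  by_cases hsmall : ∃ d : Set Ordinal.{u}, d ⊆ Iio δ ∧ #d < lift.{u + 1} κ ∧
      ∀ ξ < δ, ∃ γ ∈ d, ξ ≤ γ
  · have hd : ∃ d : Set Ordinal.{u}, d ⊆ Iio δ ∧ #d < lift.{u + 1} κ ∧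
        (∀ ξ < δ, ∃ γ ∈ d, ξ ≤ γ) ∧ (HasOmegaSeq δ → c δ = d) := by
      by_cases hω : HasOmegaSeq δ
      · exact ⟨c δ, (hc δ hω).1, (hc δ hω).2.1.le_aleph0.trans_lt hκ', (hc δ hω).2.2, fun _ => rfl⟩
      · obtain ⟨d, h1, h2, h3⟩ := hsmall
        exact ⟨d, h1, h2, h3, fun h => absurd h hω⟩
    obtain ⟨d, hdδ, hdc, hdcof, hdω⟩ := hd
    obtain ⟨x, ⟨⟨_, i, δ', _, hsup, hω, _, hcx⟩, hxA⟩, _, hsub⟩ :=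
      hst.exists_superset hκ.lift hκ' ⟨hdδ.trans hsubA, hdc⟩
    obtain rfl := hsup.eq_of_subset (fun α hα hαp => (hAδ α hαp).1 (hxA.1 hα)) hδp hdδ hdcof hsub
    exact hcx ((hdω hω).trans_subset hsub)
  · push Not at hsmall
    have : ∀ ξ < κ.ord, ∃ b < δ, ∀ α < δ, g δ α < ξ → α < b := by
      intro ξ hξ
      obtain ⟨b, hb, hb'⟩ := hsmall {α | α < δ ∧ g δ α < ξ} (fun α hα => hα.1) (by
        refine (mk_le_of_injective (β := Iio ξ) (f := fun a => ⟨g δ a.1, a.2.2⟩) ?_).trans_lt ?_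
        · intro a b hab
          exact Subtype.ext (hg' δ hδp a.2.1 b.2.1 (congrArg Subtype.val hab))
        · rw [Cardinal.mk_Iio_ordinal, Cardinal.lift_lt]
          exact lt_ord.1 hξ)
      exact ⟨b, hb, fun α h1 h2 => hb' α ⟨h1, h2⟩⟩
    choose! h hh hh' using this
    let F : Finset Ordinal.{u} → Set Ordinal.{u} := fun s =>
      ((h '' s ∪ g δ '' s) ∩ A)
    obtain ⟨x, ⟨⟨_, i, δ', hco, hsup, ⟨s, hs, hscof⟩, hi, _⟩, hxA⟩, _, hcl⟩ := hst.2 _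
      (isClubIn_setOf_isClosedUnder hκ.lift hκ' (A := A) (F := F) (fun s =>
        (lt_aleph0_iff_set_finite.2 (((s.finite_toSet.image h).union
          (s.finite_toSet.image (g δ))).inter_of_left A)).trans hκ')
        fun s _ => inter_subset_right)
    have hclh : ∀ ξ ∈ x, ξ < κ.ord → h ξ ∈ x := fun ξ hξ hξκ => hcl {ξ} (by simpa using hξ)
      ⟨Or.inl (mem_image_of_mem h (by simp)), hsubA (hh ξ hξκ)⟩
    have hclg : ∀ α ∈ x, α < δ → g δ α ∈ x := fun α hα hαδ => hcl {α} (by simpa using hα)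
      ⟨Or.inr (mem_image_of_mem (g δ) (by simp)), hκA (hg δ hδp α hαδ)⟩
    choose a hax hap hsa using fun n => hsup.cofinal (s n) (hs n)
    have haδ : ∀ n, a n < δ := fun n => (hAδ _ (hap n)).1 (hxA.1 (hax n))
    refine hi ⟨fun n => g δ (a n), fun n => ?_, fun η hη => ?_⟩
    · exact (hco.mem_iff _ (hg δ hδp _ (haδ n))).1 (hclg _ (hax n) (haδ n))
    · have hηκ := hη.trans hco.lt
      have hhη := hclh η ((hco.mem_iff η hηκ).2 hη) hηκ
      obtain ⟨n, hn⟩ := hscof _ (hsup.lt _ hhη ((hh η hηκ).trans hδp))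
      refine ⟨n, ?_⟩
      by_contra! hlt
      exact (hh' η hηκ _ (haδ n) hlt).not_ge (hn.trans (hsa n))

end LadderSet

section Stationary

variable {κ l : Cardinal.{u}} {F : Finset Ordinal.{u} → Set Ordinal.{u}}

/-- For some level `i` of uncountable cofinality, the second player does not lose the game of
enlarging the hull of `i` without adding ordinals below `κ`. -/
theorem exists_survives_empty (hκ : κ.IsRegular) (hκ₁ : ℵ_ (1 : Ordinal.{u}) < κ)
    (hF : ∀ s, #(F s) < lift.{u + 1} κ) :
    ∃ i < κ.ord, ¬ HasOmegaSeq i ∧ Survives (Order.succ κ).ord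
      (fun s => hull F (Iio i ∪ ↑s) ∩ Iio κ.ord ⊆ Iio i) ∅ := by
  have hK : ℵ₀ < lift.{u + 1} κ := by
    rw [← Cardinal.lift_aleph0.{u + 1, u}, Cardinal.lift_lt]
    exact aleph0_lt_aleph_one.trans hκ₁
  have hsucc : (Order.succ κ).IsRegular := isRegular_succ hκ.aleph0_le
  choose τ hτ hwin using fun i : Ordinal.{u} => exists_strategy hsucc.ord_pos
    (fun s => hull F (Iio i ∪ ↑s) ∩ Iio κ.ord ⊆ Iio i)
  have hbound : ∀ s, ∃ b < (Order.succ κ).ord, ∀ β ∈ (fun i => τ i s) '' Iio κ.ord, β < b := by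
    intro s
    refine exists_lt_ord_forall_lt hsucc ?_ (mk_image_le.trans_lt ?_)
    · rintro _ ⟨i, _, rfl⟩
      exact hτ i s
    · rw [mk_Iio_ord, Cardinal.lift_lt]
      exact Order.lt_succ κ
  choose b hb hb' using hbound
  obtain ⟨i, hi, hiω, hhull⟩ := exists_hull_Iio_inter_subset hκ hκ₁ (F := fun s => F s ∪ {b s})
    fun s => mk_union_lt hK (hF s) ((lt_aleph0_of_finite _).trans hK)
  refine ⟨i, hi, hiω, hwin i (hull (fun s => F s ∪ {b s}) (Iio i)) (fun s hs => ?_)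
    (fun s hs => ⟨b s, isClosedUnder_hull _ _ s hs (Or.inr rfl), hb' s _ ⟨i, hi, rfl⟩, hb s⟩)
    ∅ (by simp)⟩
  refine Subset.trans (inter_subset_inter_left _ (hull_subset (union_subset (subset_hull _ _) hs)
    fun t ht => ?_)) hhull
  exact subset_union_left.trans (isClosedUnder_hull (fun s => F s ∪ {b s}) _ t ht)

/-- Closure points, of countable cofinality, of a family of finite sets with unboundedly many
one-point extensions. -/
theorem exists_closure_point (hκ : κ.IsRegular) (hκ' : ℵ₀ < lift.{u + 1} κ)
    (hF : ∀ s, #(F s) < lift.{u + 1} κ) {i : Ordinal.{u}} (hi : i < κ.ord)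
    {T : Finset Ordinal.{u} → Prop} (h0 : T ∅)
    (hT : ∀ s, T s → ∀ α < (Order.succ κ).ord, ∃ β, α < β ∧ β < (Order.succ κ).ord ∧
      T (insert β s)) :
    ∃ δ < (Order.succ κ).ord, HasOmegaSeq δ ∧
      (∀ s : Finset Ordinal.{u}, (s : Set _) ⊆ Iio δ → T s → ∀ α < δ, ∃ β, α < β ∧ β < δ ∧
        T (insert β s)) ∧
      (∀ s : Finset Ordinal.{u}, (s : Set _) ⊆ Iio δ →
        hull F (Iio i ∪ ↑s) ∩ Iio (Order.succ κ).ord ⊆ Iio δ) ∧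
      lift.{u + 1} κ ≤ #{β | β < δ ∧ T {β}} := by
  classical
  set p := (Order.succ κ).ord with hp
  have hsucc : (Order.succ κ).IsRegular := isRegular_succ hκ.aleph0_le
  have hlt : lift.{u + 1} κ < lift.{u + 1} (Order.succ κ) :=
    Cardinal.lift_lt.2 (Order.lt_succ κ)
  have hsucc' : ℵ₀ < lift.{u + 1} (Order.succ κ) := hκ'.trans hlt
  have hi' : #(Iio i) < lift.{u + 1} κ := by
    rw [Cardinal.mk_Iio_ordinal, Cardinal.lift_lt]
    exact lt_ord.1 hi
  choose! w hw hwp hwT using hT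
  obtain ⟨δ₀, hδ₀, hcard⟩ : ∃ δ₀ < p, lift.{u + 1} κ ≤ #{β | β < δ₀ ∧ T {β}} := by
    have hU : lift.{u + 1} κ ≤ #{β | β < p ∧ T {β}} := by
      by_contra! hsmall
      obtain ⟨b, hb, hb'⟩ := exists_lt_ord_forall_lt hsucc (B := {β | β < p ∧ T {β}})
        (fun β hβ => hβ.1) (hsmall.trans hlt)
      exact (hb' (w ∅ b) ⟨hwp ∅ h0 b hb, by simpa using hwT ∅ h0 b hb⟩).not_gt (hw ∅ h0 b hb)
    obtain ⟨B, hBsub, hB⟩ := le_mk_iff_exists_subset.1 hU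
    obtain ⟨b, hb, hb'⟩ := exists_lt_ord_forall_lt hsucc (B := B)
      (fun β hβ => (hBsub hβ).1) (hB.trans_lt hlt)
    exact ⟨b, hb, hB.ge.trans (mk_le_mk_of_subset fun β hβ => ⟨hb' β hβ, (hBsub hβ).2⟩)⟩
  have hstep : ∀ ζ < p, ∃ b < p, ζ < b ∧ ∀ s : Finset Ordinal.{u}, (s : Set _) ⊆ Iio ζ →
      (T s → w s ζ < b) ∧ hull F (Iio i ∪ ↑s) ∩ Iio p ⊆ Iio b := by
    intro ζ hζ
    let E : Finset (Iio ζ) → Finset Ordinal.{u} := fun s => s.map (Function.Embedding.subtype _)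
    obtain ⟨b, hb, hb'⟩ := exists_lt_ord_forall_lt hsucc
      (B := {ζ} ∪ ⋃ s : Finset (Iio ζ), ({β | β = w (E s) ζ ∧ β < p} ∪
        (hull F (Iio i ∪ ↑(E s)) ∩ Iio p))) (by
          refine union_subset (by simpa using hζ) (iUnion_subset fun s => ?_)
          exact union_subset (fun β hβ => hβ.2) inter_subset_right) (by
          refine mk_union_lt hsucc' ((lt_aleph0_of_finite _).trans hsucc') (mk_iUnion_lt hsucc.lift
            (mk_finset_lt hsucc' ?_) fun s => mk_union_lt hsucc' ?_ ?_)
          · rw [Cardinal.mk_Iio_ordinal, Cardinal.lift_lt]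
            exact lt_ord.1 hζ
          · refine lt_of_le_of_lt (mk_le_mk_of_subset (t := {w (E s) ζ}) fun β hβ => hβ.1) ?_
            exact (lt_aleph0_of_finite _).trans hsucc'
          · refine (mk_le_mk_of_subset inter_subset_left).trans_lt (lt_trans ?_ hlt)
            exact mk_hull_lt hκ.lift hκ' hF (mk_union_lt hκ' hi'
              ((lt_aleph0_of_finite _).trans hκ')))
    refine ⟨b, hb, hb' ζ (Or.inl rfl), fun s hs => ?_⟩
    have hEs : E (s.subtype (· ∈ Iio ζ)) = s := Finset.subtype_map_of_mem fun x hx => hs hx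
    refine ⟨fun hTs => hb' _ (Or.inr (mem_iUnion.2 ⟨s.subtype (· ∈ Iio ζ), Or.inl ?_⟩)),
      fun β hβ => hb' _ (Or.inr (mem_iUnion.2 ⟨s.subtype (· ∈ Iio ζ), Or.inr ?_⟩))⟩
    · rw [hEs]
      exact ⟨rfl, hwp s hTs ζ hζ⟩
    · rwa [hEs]
  choose! b hbp hbgt hbs using hstep
  let d : ℕ → Ordinal.{u} := fun n => b^[n] δ₀
  have hd : ∀ n, d (n + 1) = b (d n) := fun n => Function.iterate_succ_apply' _ _ _
  have hdp : ∀ n, d n < p := by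
    intro n
    induction n with
    | zero => exact hδ₀
    | succ n ih => rw [hd]; exact hbp _ ih
  have hmono : StrictMono d := strictMono_nat_of_lt_succ fun n => by
    rw [hd]; exact hbgt _ (hdp n)
  have hsup : ∀ a, a < ⨆ n, d n ↔ ∃ n, a < d n := fun a => Ordinal.lt_iSup_iff
  have hδ : ∀ n, d n < ⨆ n, d n := fun n => (hsup _).2 ⟨n + 1, hmono (Nat.lt_succ_self n)⟩
  have hfin : ∀ s : Finset Ordinal.{u}, (s : Set _) ⊆ Iio (⨆ n, d n) →
      ∃ n, (s : Set _) ⊆ Iio (d n) := by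
    intro s hs
    refine exists_finset_subset_of_directed (y := fun n => Iio (d n))
      (Monotone.directed_le fun m n hmn => Iio_subset_Iio (hmono.monotone hmn)) s fun a ha => ?_
    exact mem_iUnion.2 ((hsup a).1 (hs ha))
  refine ⟨⨆ n, d n, ?_, ⟨d, hδ, fun ξ hξ => ?_⟩, fun s hs hTs α hα => ?_, fun s hs => ?_, ?_⟩
  · obtain ⟨e, he, he'⟩ := exists_lt_ord_forall_lt hsucc (B := range d)
      (by rintro _ ⟨n, rfl⟩; exact hdp n) ((countable_range d).le_aleph0.trans_lt hsucc')
    exact (Ordinal.iSup_le fun n => (he' _ ⟨n, rfl⟩).le).trans_lt he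
  · obtain ⟨n, hn⟩ := (hsup ξ).1 hξ
    exact ⟨n, hn.le⟩
  · obtain ⟨n, hn⟩ := hfin s hs
    obtain ⟨m, hm⟩ := (hsup α).1 hα
    set N := max m n
    have hsN : (s : Set _) ⊆ Iio (d N) :=
      hn.trans (Iio_subset_Iio (hmono.monotone (le_max_right _ _)))
    refine ⟨w s (d N), ?_, ?_, hwT s hTs _ (hdp N)⟩
    · exact (hm.trans_le (hmono.monotone (le_max_left _ _))).trans (hw s hTs _ (hdp N))
    · refine lt_trans ?_ (hδ (N + 1))
      rw [hd]
      exact (hbs _ (hdp N) s hsN).1 hTs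
  · obtain ⟨n, hn⟩ := hfin s hs
    refine (hbs _ (hdp n) s hn).2.trans (Iio_subset_Iio ?_)
    rw [← hd]
    exact (hδ _).le
  · exact hcard.trans (mk_le_mk_of_subset fun β hβ => ⟨hβ.1.trans (hδ 0), hβ.2⟩)

/-- A branch through a family of finite sets whose hulls add no ordinals below `κ`. -/
theorem exists_branch (hκ : κ.IsRegular) (hκ' : ℵ₀ < lift.{u + 1} κ)
    (hF : ∀ s, #(F s) < lift.{u + 1} κ) {i δ β₀ : Ordinal.{u}} (hi : i < κ.ord)
    {T : Finset Ordinal.{u} → Prop}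
    (hTF : ∀ s, T s → hull F (Iio i ∪ ↑s) ∩ Iio κ.ord ⊆ Iio i)
    (hδp : δ < (Order.succ κ).ord) (hω : HasOmegaSeq δ)
    (hT : ∀ s : Finset Ordinal.{u}, (s : Set _) ⊆ Iio δ → T s → ∀ α < δ, ∃ β, α < β ∧ β < δ ∧
      T (insert β s))
    (hδ : ∀ s : Finset Ordinal.{u}, (s : Set _) ⊆ Iio δ →
      hull F (Iio i ∪ ↑s) ∩ Iio (Order.succ κ).ord ⊆ Iio δ)
    (hβ₀ : β₀ < δ) (hTβ : T {β₀}) :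
    ∃ y : Set Ordinal.{u}, y ⊆ Iio δ ∧ β₀ ∈ y ∧ #(hull F (Iio i ∪ y)) < lift.{u + 1} κ ∧
      (∀ ξ < κ.ord, ξ ∈ hull F (Iio i ∪ y) ↔ ξ < i) ∧
      IsSupBelow (Order.succ κ).ord (hull F (Iio i ∪ y)) δ := by
  classical
  obtain ⟨e, he, hecof⟩ := hω
  choose! w hw hwδ hwT using hT
  obtain ⟨S, hS0, hS1⟩ : ∃ S : ℕ → Finset Ordinal.{u}, S 0 = {β₀} ∧
      ∀ n, S (n + 1) = insert (w (S n) (e n)) (S n) :=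
    ⟨fun n => Nat.rec {β₀} (fun n s => insert (w s (e n)) s) n, rfl, fun _ => rfl⟩
  have hS : ∀ n, (S n : Set Ordinal.{u}) ⊆ Iio δ ∧ T (S n) := by
    intro n
    induction n with
    | zero => exact ⟨by simpa [hS0] using hβ₀, hS0 ▸ hTβ⟩
    | succ n ih =>
      rw [hS1]
      refine ⟨?_, hwT _ ih.1 ih.2 _ (he n)⟩
      rw [Finset.coe_insert, insert_subset_iff]
      exact ⟨hwδ _ ih.1 ih.2 _ (he n), ih.1⟩
  have hmono : Monotone S := monotone_nat_of_le_succ fun n => by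
    rw [hS1]; exact Finset.subset_insert _ _
  have hdir : Directed (· ⊆ ·) fun n => Iio i ∪ (S n : Set Ordinal.{u}) :=
    Monotone.directed_le fun m n h => union_subset_union_right _ (Finset.coe_subset.2 (hmono h))
  have hcov : hull F (Iio i ∪ ⋃ n, (S n : Set Ordinal.{u})) ⊆
      ⋃ n, hull F (Iio i ∪ (S n : Set Ordinal.{u})) := by
    rw [union_iUnion (Iio i) fun n => (S n : Set Ordinal.{u})]
    exact hull_iUnion_subset hdir
  refine ⟨⋃ n, ↑(S n), iUnion_subset fun n => (hS n).1,
    mem_iUnion.2 ⟨0, by simp [hS0]⟩, mk_hull_lt hκ.lift hκ' hF (mk_union_lt hκ' ?_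
      (mk_iUnion_nat_lt hκ.lift hκ' fun n => (lt_aleph0_of_finite _).trans hκ')),
    fun ξ hξ => ⟨fun h => ?_, fun h => subset_hull _ _ (Or.inl h)⟩, ⟨fun α hα hαp => ?_,
      fun α hα => ?_⟩⟩
  · rw [Cardinal.mk_Iio_ordinal, Cardinal.lift_lt]
    exact lt_ord.1 hi
  · obtain ⟨n, hn⟩ := mem_iUnion.1 (hcov h)
    exact hTF _ (hS n).2 ⟨hn, hξ⟩
  · obtain ⟨n, hn⟩ := mem_iUnion.1 (hcov hα)
    exact hδ _ (hS n).1 ⟨hn, hαp⟩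
  · obtain ⟨n, hn⟩ := hecof α hα
    have h1 := hw _ (hS n).1 (hS n).2 _ (he n)
    have h2 := hwδ _ (hS n).1 (hS n).2 _ (he n)
    refine ⟨w (S n) (e n), subset_hull _ _ (Or.inr (mem_iUnion.2 ⟨n + 1, ?_⟩)), h2.trans hδp,
      hn.trans h1.le⟩
    rw [hS1]
    simp

/-- Coherent sets with the same trace on `κ` and the same supremum, both containing a common
cofinal set, agree below `κ⁺`. -/
theorem IsCoherent.mem_of_mem {g : Ordinal.{u} → Ordinal.{u} → Ordinal.{u}}
    {x x' d : Set Ordinal.{u}} {i δ α : Ordinal.{u}} (hx : IsCoherent κ g x i)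
    (hx' : IsCoherent κ g x' i) (hδ : δ < (Order.succ κ).ord) (hd : d ⊆ Iio δ)
    (hd' : ∀ ξ < δ, ∃ γ ∈ d, ξ ≤ γ) (hdx : d ⊆ x) (hdx' : d ⊆ x') (hα : α ∈ x) (hαδ : α < δ) :
    α ∈ x' := by
  obtain ⟨γ, hγ, hle⟩ := hd' α hαδ
  rcases hle.eq_or_lt with rfl | hlt
  · exact hdx' hγ
  · have hγp := (hd hγ).trans hδ
    exact (hx'.initial γ (hdx' hγ) hγp α hlt).2 ((hx.initial γ (hdx hγ) hγp α hlt).1 hα)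

theorem isStationaryIn_ladderSet (hκ : κ.IsRegular) (hκ₁ : ℵ_ (1 : Ordinal.{u}) < κ)
    (hl : Order.succ κ ≤ l) {g f : Ordinal.{u} → Ordinal.{u} → Ordinal.{u}}
    (hgf : ∀ α < (Order.succ κ).ord, ∀ β < α, g α β < κ.ord ∧ f α (g α β) = β)
    {c : Ordinal.{u} → Set Ordinal.{u}}
    (hc : ∀ δ, HasOmegaSeq δ → c δ ⊆ Iio δ ∧ (c δ).Countable ∧ ∀ ξ < δ, ∃ γ ∈ c δ, ξ ≤ γ) :
    IsStationaryIn (lift.{u + 1} κ) (Iio l.ord) (ladderSet κ l g c) := by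
  have hκ' : ℵ₀ < lift.{u + 1} κ := by
    rw [← Cardinal.lift_aleph0.{u + 1, u}, Cardinal.lift_lt]
    exact aleph0_lt_aleph_one.trans hκ₁
  refine ⟨fun x hx => hx.1, fun C hC => ?_⟩
  by_contra hne
  rw [not_nonempty_iff_eq_empty] at hne
  have hpl : (Order.succ κ).ord ≤ l.ord := ord_le_ord.2 hl
  have hkp : κ.ord < (Order.succ κ).ord := ord_lt_ord.2 (Order.lt_succ κ)
  obtain ⟨F₀, hF₀, hF₀C⟩ := hC.exists_isClosedUnder hκ.lift hκ'
  let G : Finset Ordinal.{u} → Set Ordinal.{u} := fun s =>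
    (image2 g s s ∪ image2 f s s) ∩ Iio (Order.succ κ).ord
  have hG : ∀ s, (G s).Finite := fun s =>
    ((s.finite_toSet.image2 g s.finite_toSet).union
      (s.finite_toSet.image2 f s.finite_toSet)).inter_of_left _
  let F : Finset Ordinal.{u} → Set Ordinal.{u} := fun s => F₀ s ∪ G s
  have hF : ∀ s, #(F s) < lift.{u + 1} κ := fun s =>
    mk_union_lt hκ' (hF₀ s).2 ((lt_aleph0_iff_set_finite.2 (hG s)).trans hκ')
  have hFl : ∀ s, F s ⊆ Iio l.ord := fun s => union_subset (hF₀ s).1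
    (inter_subset_right.trans (Iio_subset_Iio hpl))
  obtain ⟨i, hi, hiω, hsurv⟩ := exists_survives_empty hκ hκ₁ hF
  obtain ⟨δ, hδp, hδω, hδT, hδF, hδcard⟩ := exists_closure_point hκ hκ' hF hi hsurv
    fun s hs α hα => hs.exists_insert hα
  have hbranch : ∀ β ∈ {β | β < δ ∧ Survives (Order.succ κ).ord
      (fun s => hull F (Iio i ∪ ↑s) ∩ Iio κ.ord ⊆ Iio i) {β}},
      ∃ x : Set Ordinal.{u}, β ∈ x ∧ #x < lift.{u + 1} κ ∧ IsCoherent κ g x i ∧ c δ ⊆ x := by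
    rintro β ⟨hβδ, hβ⟩
    obtain ⟨y, hyδ, hβy, hcard, htrace, hsup⟩ := exists_branch hκ hκ' hF hi
      (fun s hs => Survives.prop hs) hδp hδω hδT hδF hβδ hβ
    have hcl := isClosedUnder_hull F (Iio i ∪ y)
    set x := hull F (Iio i ∪ y)
    have hxl : x ∈ Pk (lift.{u + 1} κ) (Iio l.ord) :=
      ⟨hull_subset (union_subset (Iio_subset_Iio (hi.trans (hkp.trans_le hpl)).le)
        (hyδ.trans (Iio_subset_Iio (hδp.trans_le hpl).le))) fun s _ => hFl s, hcard⟩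
    have hpair : ∀ α ∈ x, ∀ β ∈ x, G {α, β} ⊆ x := fun α hα β hβ =>
      subset_union_right.trans (hcl {α, β} (by
        rw [Finset.coe_pair]; exact pair_subset hα hβ))
    have hco : IsCoherent κ g x i := by
      refine ⟨hi, htrace, fun α hα hαp γ hγ => ⟨fun h => ?_, fun h => ?_⟩⟩
      · refine (htrace _ (hgf α hαp γ hγ).1).1 (hpair α hα γ h ⟨Or.inl ?_, ?_⟩)
        · exact ⟨α, by simp, γ, by simp, rfl⟩
        · exact (hgf α hαp γ hγ).1.trans hkp
      · refine hpair α hα (g α γ) ((htrace _ (hgf α hαp γ hγ).1).2 h) ⟨Or.inr ?_, ?_⟩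
        · exact ⟨α, by simp, g α γ, by simp, (hgf α hαp γ hγ).2⟩
        · exact hγ.trans hαp
    have hxC : x ∈ C := hF₀C x hxl fun s hs => subset_union_left.trans (hcl s hs)
    refine ⟨x, subset_hull _ _ (Or.inr hβy), hcard, hco, by_contra fun hcx => ?_⟩
    exact hne.subset ⟨⟨hxl, i, δ, hco, hsup, hδω, hiω, hcx⟩, hxC⟩
  obtain ⟨hc1, -, hc2⟩ := hc δ hδω
  obtain ⟨⟨β₀, hβ₀⟩⟩ := mk_ne_zero_iff.1 ((aleph0_pos.trans (hκ'.trans_le hδcard)).ne')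
  obtain ⟨x₀, -, hx₀card, hx₀, hcx₀⟩ := hbranch β₀ hβ₀
  refine (hδcard.trans (mk_le_mk_of_subset fun β hβ => ?_)).not_gt hx₀card
  obtain ⟨x, hβx, -, hx, hcx⟩ := hbranch β hβ
  exact hx.mem_of_mem hx₀ hδp hc1 hc2 hcx hcx₀ hβx hβ.1

theorem not_stationaryReflection (hκ : κ.IsRegular) (hκ₁ : ℵ_ (1 : Ordinal.{u}) < κ)
    (hl : Order.succ κ ≤ l) : ¬ StationaryReflection κ l := by
  intro h
  have hκ' : ℵ₀ < lift.{u + 1} κ := by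
    rw [← Cardinal.lift_aleph0.{u + 1, u}, Cardinal.lift_lt]
    exact aleph0_lt_aleph_one.trans hκ₁
  obtain ⟨c, hc⟩ := exists_omega_ladder.{u}
  obtain ⟨g, f, hgf⟩ := exists_injections κ
  obtain ⟨A, hκA, -, hA, hst⟩ := h _ (isStationaryIn_ladderSet hκ hκ₁ hl hgf hc)
  refine not_isStationaryIn_ladderSet hκ hκ' (fun α hα β hβ => (hgf α hα β hβ).1)
    (fun α hα β hβ γ hγ hβγ => ?_) hc hκA hA hst
  rw [← (hgf α hα β hβ).2, hβγ, (hgf α hα γ hγ).2]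

end Stationary

section Covering

/-- `cf(ν, γ) ≤ ν` for `|γ| = ν`: the images of the initial segments of `ν` are unbounded. -/
theorem cfBelow_succ {ν : Cardinal.{u}} (hν : ν.IsRegular) : CfBelow ν (Order.succ ν) := by
  intro γ hνγ hγ
  have hcard : #(Iio γ) = #(Iio ν.ord) := by
    rw [mk_Iio_ord, Cardinal.mk_Iio_ordinal]
    exact congrArg _ (le_antisymm (Order.lt_succ_iff.1 (lt_ord.1 hγ)) (ord_le.1 hνγ.le))
  obtain ⟨e⟩ := Cardinal.eq.1 hcard.symm
  let t : Iio ν.ord → Set Ordinal.{u} := fun ξ => (fun a => (e a : Ordinal.{u})) '' Iio ξ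
  have ht : ∀ ξ, t ξ ∈ Pk (lift.{u + 1} ν) (Iio γ) := by
    intro ξ
    refine ⟨?_, mk_image_le.trans_lt ?_⟩
    · rintro _ ⟨a, _, rfl⟩
      exact (e a).2
    · refine (mk_le_of_injective (β := Iio ξ.1) (f := fun a => ⟨a.1.1, a.2⟩) ?_).trans_lt ?_
      · intro a b hab
        exact Subtype.ext (Subtype.ext (Subtype.mk.inj hab))
      · rw [Cardinal.mk_Iio_ordinal, Cardinal.lift_lt]
        exact lt_ord.1 ξ.2
  refine lt_of_le_of_lt (csInf_le' ⟨range t, ⟨?_, fun x hx => ?_⟩, rfl⟩)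
    (mk_range_le.trans_lt ?_)
  · rintro _ ⟨ξ, rfl⟩
    exact ht ξ
  · obtain ⟨b, hb, hb'⟩ := exists_lt_ord_forall_lt hν
      (B := (fun a : Iio γ => (e.symm a : Ordinal.{u})) '' {a | a.1 ∈ x}) (by
        rintro _ ⟨a, _, rfl⟩; exact (e.symm a).2) (mk_image_le.trans_lt (lt_of_le_of_lt
          (mk_le_of_injective (β := x) (f := fun a => ⟨a.1.1, a.2⟩) fun a b hab =>
            Subtype.ext (Subtype.ext (Subtype.mk.inj hab))) hx.2))
    refine ⟨t ⟨b, hb⟩, mem_range_self _, fun a ha => ⟨e.symm ⟨a, hx.1 ha⟩, ?_, by simp⟩⟩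
    exact hb' _ ⟨⟨a, hx.1 ha⟩, ha, rfl⟩
  · rw [mk_Iio_ord, Cardinal.lift_lt]
    exact Order.lt_succ ν

/-- If `κ` is countably closed, then `𝒫_{ω₁} γ` has size `< κ` for `γ < κ`. -/
theorem cfBelow_aleph_one {κ : Cardinal.{u}}
    (hκ : ∀ γ : Cardinal.{u}, γ < κ → γ ^ (ℵ₀ : Cardinal.{u}) < κ) : CfBelow (ℵ_ 1) κ := by
  intro γ hνγ hγ
  have hω : ℵ₀ ≤ γ.card := aleph0_lt_aleph_one.le.trans (ord_le.1 hνγ.le)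
  refine lt_of_le_of_lt (csInf_le' ⟨Pk (lift.{u + 1, u} (ℵ_ 1)) (Iio γ),
    ⟨subset_rfl, fun x hx => ⟨x, hx, subset_rfl⟩⟩, rfl⟩) ?_
  have hle : #(Pk (lift.{u + 1, u} (ℵ_ 1)) (Iio γ)) ≤
      #{t : Set Ordinal.{u} // t ⊆ Iio γ ∧ #t ≤ ℵ₀} := by
    refine mk_le_mk_of_subset fun x hx => ⟨hx.1, ?_⟩
    rw [← Order.lt_succ_iff, succ_aleph0]
    simpa using hx.2
  refine (hle.trans (mk_bounded_subset_le _ _)).trans_lt ?_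
  rw [Cardinal.mk_Iio_ordinal, max_eq_left (Cardinal.aleph0_le_lift.2 hω), ← Cardinal.lift_aleph0.{u + 1, u},
    ← Cardinal.lift_power, Cardinal.lift_lt]
  exact hκ _ (lt_ord.1 hγ)

end Covering

end PkReflection

theorem theorem2 (ν κ : Cardinal.{u}) (hν : ν.IsRegular) (hκ : κ.IsRegular)
    (hν_unc : Cardinal.aleph0 < ν) (hνκ : ν < κ) :
    (PkReflection.CfBelow ν κ →
      ∀ l : Cardinal.{u}, Order.succ κ ≤ l → ¬ PkReflection.StationaryReflection κ l) ∧
    (κ = Order.succ ν → PkReflection.CfBelow ν κ) ∧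
    (ν = Cardinal.aleph 1 → (∀ γ : Cardinal.{u}, γ < κ → γ ^ Cardinal.aleph0.{u} < κ) →
      PkReflection.CfBelow ν κ) := by
  refine ⟨fun _ l hl => PkReflection.not_stationaryReflection hκ ?_ hl, ?_, ?_⟩
  · refine lt_of_le_of_lt ?_ hνκ
    rw [← Cardinal.succ_aleph0]
    exact Order.succ_le_of_lt hν_unc
  · rintro rfl
    exact PkReflection.cfBelow_succ hν
  · rintro rfl h
    exact PkReflection.cfBelow_aleph_one h
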